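/- Let $n\ge 2$, $0<\rho<\tfrac12$, $0<\theta<\tfrac{\pi}{2}$. Write $x=(x',x_n)\in\mathbb R^{n-1}\times\mathbb R$, let $e_n$ be the unit vector in the $x_n$-direction, and let $B(c,r)$ be the open ball with centre $c$ and radius $r$, $B_1=B(0,1)$. Put $$\mathscr A_{\rho,\theta}=\{x\in B_1:\ x_n<\cot\theta\,|x'|,\ |x-\rho e_n|>\rho\},\qquad \Sigma_\theta=\{x\in S^{n-1}:\ x_n<\cot\theta\,|x'|\},$$ and let $\lambda_1(n,\theta)$ be the first Dirichlet eigenvalue of the Laplace–Beltrami operator on $\Sigma_\theta$, that is, $\lambda_1(n,\theta)=\inf\int_{\Sigma_\theta}|\nabla\varphi|^2dS\big/\int_{\Sigma_\theta}\varphi^2dS$ over $0\ne\varphi\in C_c^\infty(\Sigma_\theta)$. For an open set $U\subset\mathbb R^n$ with $0\notin U$ let $$H(U)=\inf_{0\neq u\in C_c^\infty(U)}\frac{\int_U|\nabla u|^2\,dx}{\int_U \frac{u^2}{|x|^2}\,dx}$$ be its Hardy constant. An exterior ball of $U$ at $0$ is a ball $B(c,r)$ with $|c|=r>0$ contained in the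 complement of $\overline U$. Let $\Omega\subset\mathbb R^n$ be a domain (open and connected) that contains $\mathscr A_{\rho,\theta}$ and whose largest exterior ball at $0$ is $B(\rho e_n,\rho)$. Then $\lambda_1(n,\theta)<n-1$, and if $$\rho<\frac{1}{2\cos\theta}\,\exp\Big(-\frac{\pi}{\sqrt{n-1-\lambda_1(n,\theta)}}\Big),$$ then $$H(\Omega)\ \le\ H(\mathscr A_{\rho,\theta})\ <\ \frac{n^2}{4}.$$ In particular the Hardy inequality with constant $n^2/4$ fails in $\Omega$: there is $u\in C_c^\infty(\Omega)$ with $\int_\Omega|\nabla u|^2dx<\frac{n^2}{4}\int_\Omega\frac{u^2}{|x|^2}dx$. -/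

import Mathlib

open MeasureTheory Metric Set
open scoped ContDiff

noncomputable section

namespace HardyBoundary

/-- Euclidean space `ℝⁿ`. -/
abbrev E (n : ℕ) : Type := EuclideanSpace ℝ (Fin n)

/-- The unit sphere `S^{n-1}` of `ℝⁿ`. -/
abbrev S (n : ℕ) : Type := sphere (0 : E n) 1

/-- The index of the last coordinate `x_n` of a point `x = (x', x_n)` of `ℝⁿ`. -/
def last (n : ℕ) (hn : 2 ≤ n) : Fin n := ⟨n - 1, by omega⟩

/-- The unit vector `e_n` in the direction of the last coordinate. -/
def eLast (n : ℕ) (hn : 2 ≤ n) : E n := EuclideanSpace.single (last n hn) (1 : ℝ)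

/-- The Euclidean norm `|x'|` of the first `n - 1` coordinates of `x = (x', x_n)`. -/
def normPrime {n : ℕ} (hn : 2 ≤ n) (x : E n) : ℝ :=
  √(∑ i ∈ Finset.univ.erase (last n hn), x i ^ 2)

/-! ### Hardy constant of an open set -/

/-- `u ∈ C_c^∞(Ω)`: a smooth function on `ℝⁿ` with compact support contained in `Ω`. -/
structure IsTestFunction {n : ℕ} (Ω : Set (E n)) (u : E n → ℝ) : Prop where
  smooth : ContDiff ℝ ∞ u
  compact : HasCompactSupport u
  support_subset : tsupport u ⊆ Ω

/-- The Dirichlet energy `∫_Ω |∇u|² dx`. -/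
def energy {n : ℕ} (Ω : Set (E n)) (u : E n → ℝ) : ℝ :=
  ∫ x in Ω, ‖gradient u x‖ ^ 2

/-- The Hardy term `∫_Ω u² / |x|² dx`. -/
def hardyTerm {n : ℕ} (Ω : Set (E n)) (u : E n → ℝ) : ℝ :=
  ∫ x in Ω, u x ^ 2 / ‖x‖ ^ 2

/-- The Hardy constant of `Ω` with singularity at the origin: the infimum of
`∫_Ω |∇u|² / ∫_Ω u²/|x|²` over all `u ∈ C_c^∞(Ω)`, `u ≠ 0`. -/
def hardyConstant {n : ℕ} (Ω : Set (E n)) : ℝ :=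
  sInf {q : ℝ | ∃ u : E n → ℝ, IsTestFunction Ω u ∧ u ≠ 0 ∧ q = energy Ω u / hardyTerm Ω u}

/-! ### Exterior balls at the origin -/

/-- `B(c, r)` is an exterior ball of `Ω` at the origin: the origin lies on its boundary sphere and
the ball is contained in the complement of the closure of `Ω`. -/
def IsExteriorBallAtZero {n : ℕ} (Ω : Set (E n)) (c : E n) (r : ℝ) : Prop :=
  0 < r ∧ ‖c‖ = r ∧ ball c r ⊆ (closure Ω)ᶜ

/-- `B(c, r)` is the largest exterior ball of `Ω` at the origin. -/
def IsLargestExteriorBallAtZero {n : ℕ} (Ω : Set (E n)) (c : E n) (r : ℝ) : Prop :=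
  IsExteriorBallAtZero Ω c r ∧
    ∀ (c' : E n) (r' : ℝ), IsExteriorBallAtZero Ω c' r' → r' ≤ r

/-! ### The first Dirichlet eigenvalue of an open subset of the sphere -/

/-- The extension of a function on the sphere to a function on `ℝⁿ ∖ {0}` that is constant on rays
from the origin, `x ↦ φ (x / |x|)` (with the value `0` at the origin). -/
def rayExtension {n : ℕ} (φ : S n → ℝ) (x : E n) : ℝ :=
  open Classical in
  if hx : x = 0 then 0
  else φ ⟨‖x‖⁻¹ • x, by
    rw [mem_sphere_zero_iff_norm, norm_smul, norm_inv, norm_norm,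
      inv_mul_cancel₀ (norm_ne_zero_iff.mpr hx)]⟩

/-- `φ ∈ C_c^∞(U)` for a subset `U` of the sphere. A function on the sphere is smooth iff its
extension that is constant on rays is smooth away from the origin; the sphere being compact, only
the inclusion of the closed support in `U` has to be asked for. -/
structure IsSphericalTestFunction {n : ℕ} (U : Set (S n)) (φ : S n → ℝ) : Prop where
  smooth : ContDiffOn ℝ ∞ (rayExtension φ) {0}ᶜ
  support_subset : tsupport φ ⊆ U

/-- The gradient on the sphere for the round metric, as a vector of the ambient space:
the Euclidean gradient of the extension that is constant on rays, at points of the sphere. -/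
def sphericalGradient {n : ℕ} (φ : S n → ℝ) (ξ : S n) : E n :=
  gradient (rayExtension φ) (ξ : E n)

/-- The first eigenvalue of the Laplace–Beltrami operator on an open subset `U` of the unit sphere
under Dirichlet boundary conditions: the infimum of `∫_U |∇φ|² dS / ∫_U φ² dS` over all
`φ ∈ C_c^∞(U)`, `φ ≠ 0`, where `dS` is surface measure. -/
def firstDirichletEigenvalue {n : ℕ} (U : Set (S n)) : ℝ :=
  sInf {q : ℝ | ∃ φ : S n → ℝ, IsSphericalTestFunction U φ ∧ φ ≠ 0 ∧
    q = (∫ ξ in U, ‖sphericalGradient φ ξ‖ ^ 2 ∂(volume : Measure (E n)).toSphere) /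
      (∫ ξ in U, φ ξ ^ 2 ∂(volume : Measure (E n)).toSphere)}

/-! ### The model domain and the spherical cap -/

/-- `𝒜_{ρ,θ} = {x ∈ B_1 : x_n < cot θ |x'|, |x - ρ e_n| > ρ}`. -/
def modelDomain (n : ℕ) (hn : 2 ≤ n) (ρ θ : ℝ) : Set (E n) :=
  {x | x ∈ ball (0 : E n) 1 ∧ x (last n hn) < Real.cot θ * normPrime hn x ∧
    ρ < ‖x - ρ • eLast n hn‖}

/-- The spherical cap `Σ_θ = {(x', x_n) ∈ S^{n-1} : x_n < cot θ |x'|}`. -/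
def sphericalCap (n : ℕ) (hn : 2 ≤ n) (θ : ℝ) : Set (S n) :=
  {ξ | (ξ : E n) (last n hn) < Real.cot θ * normPrime hn (ξ : E n)}

/-- `λ_1(n, θ)`, the first Dirichlet eigenvalue of the spherical cap `Σ_θ`. -/
def capEigenvalue (n : ℕ) (hn : 2 ≤ n) (θ : ℝ) : ℝ :=
  firstDirichletEigenvalue (sphericalCap n hn θ)

end HardyBoundary

end

namespace HardyBoundary

/-! The exterior ball meets the ray in a direction `ξ` only at radii below `2ρ ξ_n`. Directions in
the cap have `ξ_n < cos θ`, so the model domain contains the truncated cone over the cap with `2ρ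
cos θ < |x| < 1`. In the variable `s = log |x|` this cone is a cylinder of length `L = -log (2ρ cos
θ)`, and there the variables separate.

For `u = v(s) e^{-(n-2)s/2} φ(ξ)` the Hardy quotient is `∫v'²/∫v² + (n-2)²/4 + ∫|∇φ|²/∫φ²`. The
first term can be brought close to `(π/L)²` and the last close to `λ₁`. Since `n²/4 - (n-2)²/4 = n -
1`, the quotient falls below `n²/4` once `(π/L)² < n - 1 - λ₁`, which is the bound on `ρ`. The
separation is `integral_norm_sq_gradient_logProduct` with `integral_logProduct_sq_div`; the assembly
is `exists_isTestFunction_modelDomain`.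

Neither eigenvalue problem is solved. One device gives both upper bounds: a convex profile `g`, a
smoothed `(c - t)₊`, is composed with `ξ_n` on the sphere (`exists_cap_test_function_quotient_lt`)
or with `-cos` on the interval (`exists_interval_test_function`). These are first eigenfunctions, up
to sign, of the hemisphere and of a slightly shorter interval. Integrating the divergence of `g g'`
times the gradient and using `g'' ≥ 0` and `t g' ≤ g` compares the quotients with those eigenvalues.
-/

/-! ### Logarithmic polar coordinates and extension along rays -/

theorem norm_exp_smul {n : ℕ} (s : ℝ) (ξ : S n) : ‖Real.exp s • (ξ : E n)‖ = Real.exp s := by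
  rw [norm_smul, norm_eq_of_mem_sphere ξ, mul_one, Real.norm_eq_abs, Real.abs_exp]

theorem exp_smul_ne_zero {n : ℕ} (s : ℝ) (ξ : S n) : Real.exp s • (ξ : E n) ≠ 0 := by
  rw [← norm_pos_iff, norm_exp_smul]
  exact Real.exp_pos s

theorem exists_exp_smul {n : ℕ} {x : E n} (hx : x ≠ 0) :
    ∃ (s : ℝ) (ξ : S n), x = Real.exp s • (ξ : E n) := by
  have h : 0 < ‖x‖ := norm_pos_iff.2 hx
  refine ⟨Real.log ‖x‖, ⟨‖x‖⁻¹ • x, ?_⟩, ?_⟩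
  · rw [mem_sphere_zero_iff_norm, norm_smul, norm_inv, norm_norm, inv_mul_cancel₀ h.ne']
  · rw [Real.exp_log h, smul_inv_smul₀ h.ne']

theorem rayExtension_pos_smul {n : ℕ} (φ : S n → ℝ) {r : ℝ} (hr : 0 < r) (x : E n) :
    rayExtension φ (r • x) = rayExtension φ x := by
  unfold rayExtension
  by_cases hx : x = 0
  · simp [hx]
  · have h : r • x ≠ 0 := smul_ne_zero hr.ne' hx
    rw [dif_neg hx, dif_neg h]
    congr 2
    rw [norm_smul, Real.norm_of_nonneg hr.le, mul_inv_rev, smul_smul,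
      mul_assoc, inv_mul_cancel₀ hr.ne', mul_one]

theorem rayExtension_coe {n : ℕ} (φ : S n → ℝ) (ξ : S n) : rayExtension φ (ξ : E n) = φ ξ := by
  unfold rayExtension
  rw [dif_neg (ne_zero_of_mem_unit_sphere ξ)]
  congr 1
  ext1
  simp [norm_eq_of_mem_sphere ξ]

theorem rayExtension_exp_smul {n : ℕ} (φ : S n → ℝ) (s : ℝ) (ξ : S n) :
    rayExtension φ (Real.exp s • (ξ : E n)) = φ ξ := by
  rw [rayExtension_pos_smul φ (Real.exp_pos s), rayExtension_coe]

theorem rayExtension_eq_homeomorph {n : ℕ} (φ : S n → ℝ) (x : ({0}ᶜ : Set (E n))) :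
    rayExtension φ x = φ (homeomorphUnitSphereProd (E n) x).1 := by
  rw [rayExtension, dif_neg (show (x : E n) ≠ 0 from x.2)]
  congr 1
  ext1
  rw [homeomorphUnitSphereProd_apply_fst_coe]

/-! ### Separated functions: integration, support, smoothness, gradient -/

/-- The function `x ↦ w (log |x|) φ (x / |x|)`. -/
noncomputable def logProduct {n : ℕ} (w : ℝ → ℝ) (φ : S n → ℝ) (x : E n) : ℝ :=
  w (Real.log ‖x‖) * rayExtension φ x

/-- Integration in logarithmic polar coordinates. -/
theorem integral_logProduct {n : ℕ} (hn : 2 ≤ n) (a : ℝ → ℝ) (b : S n → ℝ) :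
    ∫ x : E n, logProduct a b x =
      (∫ s, a s * Real.exp (n * s)) * ∫ ξ, b ξ ∂(volume : Measure (E n)).toSphere := by
  have hdim : Module.finrank ℝ (E n) = n := by simp
  have : Nontrivial (E n) := Module.nontrivial_of_finrank_pos (R := ℝ) (by omega)
  calc ∫ x : E n, logProduct a b x
      = ∫ x : ({0}ᶜ : Set (E n)), a (Real.log ‖x.1‖) * rayExtension b x
          ∂((volume : Measure (E n)).comap (↑)) := by
        simp only [logProduct]
        rw [integral_subtype_comap (measurableSet_singleton _).compl
          fun x : E n => a (Real.log ‖x‖) * rayExtension b x, restrict_compl_singleton]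
    _ = ∫ x, b x.1 * a (Real.log x.2)
          ∂((volume : Measure (E n)).toSphere.prod (.volumeIoiPow (n - 1))) := by
        have := (volume : Measure (E n)).measurePreserving_homeomorphUnitSphereProd.integral_comp
          (Homeomorph.measurableEmbedding _) (fun x => b x.1 * a (Real.log x.2))
        rw [hdim] at this
        rw [← this]
        refine integral_congr_ae (Filter.Eventually.of_forall fun x => ?_)
        simp only [rayExtension_eq_homeomorph, homeomorphUnitSphereProd_apply_snd_coe]
        rw [mul_comm]
    _ = (∫ ξ, b ξ ∂(volume : Measure (E n)).toSphere) *
          ∫ x : Ioi (0 : ℝ), a (Real.log x) ∂.volumeIoiPow (n - 1) :=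
        -- No integrability is needed: the product formula also holds with the default value `0` of
        -- a divergent integral.
        integral_prod_mul b fun x : Ioi (0 : ℝ) => a (Real.log x)
    _ = _ := by
        rw [mul_comm]
        congr 1
        -- The substitution `r = e^s` turns `r^{n-1} dr` into `e^{ns} ds`.
        simp only [Measure.volumeIoiPow, ENNReal.ofReal]
        rw [integral_withDensity_eq_integral_smul
            ((measurable_subtype_coe.pow_const _).real_toNNReal),
          integral_subtype_comap measurableSet_Ioi
            fun y => Real.toNNReal (y ^ (n - 1)) • a (Real.log y),
          ← Real.range_exp, ← image_univ,
          integral_image_eq_integral_abs_deriv_smul MeasurableSet.univ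
            (fun x _ => (Real.hasDerivAt_exp x).hasDerivWithinAt) Real.exp_injective.injOn,
          setIntegral_univ]
        refine integral_congr_ae (Filter.Eventually.of_forall fun s => ?_)
        simp only [Real.abs_exp, Real.log_exp, NNReal.smul_def, smul_eq_mul]
        rw [Real.coe_toNNReal _ (by positivity), ← Real.exp_nat_mul, ← mul_assoc, ← Real.exp_add,
          mul_comm]
        congr 2
        rw [Nat.cast_pred (by omega)]
        ring

theorem logProduct_exp_smul {n : ℕ} (w : ℝ → ℝ) (φ : S n → ℝ) (s : ℝ) (ξ : S n) :
    logProduct w φ (Real.exp s • (ξ : E n)) = w s * φ ξ := by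
  rw [logProduct, norm_exp_smul, Real.log_exp, rayExtension_exp_smul]

theorem logProduct_zero {n : ℕ} (w : ℝ → ℝ) (φ : S n → ℝ) : logProduct w φ 0 = 0 := by
  simp [logProduct, rayExtension]

theorem isCompact_exp_smul_image {n : ℕ} {w : ℝ → ℝ} (hw : HasCompactSupport w) (φ : S n → ℝ) :
    IsCompact ((fun p : ℝ × S n => Real.exp p.1 • (p.2 : E n)) '' (tsupport w ×ˢ tsupport φ)) :=
  (hw.isCompact.prod (isClosed_tsupport φ).isCompact).image (by fun_prop)

/-- The image on the right is compact, hence closed, and misses the origin. Compact support and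
regularity at `0` both follow from this. -/
theorem tsupport_logProduct_subset {n : ℕ} {w : ℝ → ℝ} (hw : HasCompactSupport w)
    (φ : S n → ℝ) :
    tsupport (logProduct w φ) ⊆
      (fun p : ℝ × S n => Real.exp p.1 • (p.2 : E n)) '' (tsupport w ×ˢ tsupport φ) := by
  refine closure_minimal (fun x hx => ?_) (isCompact_exp_smul_image hw φ).isClosed
  have hx0 : x ≠ 0 := by
    rintro rfl
    exact hx (logProduct_zero w φ)
  obtain ⟨s, ξ, rfl⟩ := exists_exp_smul hx0
  rw [Function.mem_support, logProduct_exp_smul] at hx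
  exact ⟨(s, ξ), ⟨subset_tsupport _ (left_ne_zero_of_mul hx),
    subset_tsupport _ (right_ne_zero_of_mul hx)⟩, rfl⟩

theorem hasCompactSupport_logProduct {n : ℕ} {w : ℝ → ℝ} (hw : HasCompactSupport w)
    (φ : S n → ℝ) : HasCompactSupport (logProduct w φ) :=
  (isCompact_exp_smul_image hw φ).of_isClosed_subset (isClosed_tsupport _)
    (tsupport_logProduct_subset hw φ)

theorem zero_notMem_tsupport_logProduct {n : ℕ} {w : ℝ → ℝ} (hw : HasCompactSupport w)
    (φ : S n → ℝ) : (0 : E n) ∉ tsupport (logProduct w φ) := fun h => by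
  obtain ⟨p, -, hp⟩ := tsupport_logProduct_subset hw φ h
  exact exp_smul_ne_zero p.1 p.2 hp

theorem contDiff_logProduct {n : ℕ} {w : ℝ → ℝ} (hw : HasCompactSupport w)
    (hws : ContDiff ℝ ∞ w) {φ : S n → ℝ} (hφ : ContDiffOn ℝ ∞ (rayExtension φ) {0}ᶜ) :
    ContDiff ℝ ∞ (logProduct w φ) := by
  rw [contDiff_iff_contDiffAt]
  intro x
  by_cases hx : x = 0
  · subst hx
    refine contDiffAt_const (c := (0 : ℝ)) |>.congr_of_eventuallyEq ?_
    exact notMem_tsupport_iff_eventuallyEq.1 (zero_notMem_tsupport_logProduct hw φ)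
  · have h1 : ContDiffAt ℝ ∞ (fun x : E n => Real.log ‖x‖) x :=
      (contDiffAt_norm ℝ hx).log (norm_ne_zero_iff.2 hx)
    exact (hws.contDiffAt.comp x h1).mul (hφ.contDiffAt (isOpen_compl_singleton.mem_nhds hx))

theorem continuous_logProduct {n : ℕ} {w : ℝ → ℝ} (hw : HasCompactSupport w)
    (hwc : Continuous w) {φ : S n → ℝ} (hφ : Continuous φ) : Continuous (logProduct w φ) := by
  rw [continuous_iff_continuousAt]
  intro x
  by_cases hx : x = 0
  · subst hx
    refine continuousAt_const (y := (0 : ℝ)) |>.congr ?_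
    exact (notMem_tsupport_iff_eventuallyEq.1 (zero_notMem_tsupport_logProduct hw φ)).symm
  · have h1 : ContinuousAt (fun x : E n => Real.log ‖x‖) x :=
      continuous_norm.continuousAt.log (norm_ne_zero_iff.2 hx)
    refine (hwc.continuousAt.comp h1).mul ?_
    have h2 : ContinuousOn (rayExtension φ) {0}ᶜ := by
      rw [continuousOn_iff_continuous_domRestrict]
      exact (hφ.comp (continuous_fst.comp (homeomorphUnitSphereProd (E n)).continuous)).congr
        fun x => (rayExtension_eq_homeomorph φ x).symm
    exact h2.continuousAt (isOpen_compl_singleton.mem_nhds hx)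

theorem integrable_logProduct {n : ℕ} {w : ℝ → ℝ} (hw : HasCompactSupport w)
    (hwc : Continuous w) {φ : S n → ℝ} (hφ : Continuous φ) : Integrable (logProduct w φ) :=
  (continuous_logProduct hw hwc hφ).integrable_of_hasCompactSupport
    (hasCompactSupport_logProduct hw φ)

theorem differentiableAt_rayExtension {n : ℕ} {φ : S n → ℝ}
    (hφ : ContDiffOn ℝ ∞ (rayExtension φ) {0}ᶜ) {x : E n} (hx : x ≠ 0) :
    DifferentiableAt ℝ (rayExtension φ) x :=
  (hφ.contDiffAt (isOpen_compl_singleton.mem_nhds hx)).differentiableAt (by simp)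

theorem continuous_of_contDiffOn_rayExtension {n : ℕ} {φ : S n → ℝ}
    (hφ : ContDiffOn ℝ ∞ (rayExtension φ) {0}ᶜ) : Continuous φ := by
  have h := hφ.continuousOn.comp_continuous (continuous_subtype_val (p := (· ∈ sphere (0 : E n) 1)))
    fun ξ => ne_zero_of_mem_unit_sphere ξ
  exact h.congr fun ξ => rayExtension_coe φ ξ

theorem continuous_sphericalGradient {n : ℕ} {φ : S n → ℝ}
    (hφ : ContDiffOn ℝ ∞ (rayExtension φ) {0}ᶜ) : Continuous (sphericalGradient φ) := by
  have h : ContinuousOn (gradient (rayExtension φ)) {0}ᶜ :=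
    (LinearIsometryEquiv.continuous _).comp_continuousOn
      (hφ.continuousOn_fderiv_of_isOpen isOpen_compl_singleton (by simp))
  exact h.comp_continuous (continuous_subtype_val (p := (· ∈ sphere (0 : E n) 1)))
    fun ξ => ne_zero_of_mem_unit_sphere ξ

/-- The extension is homogeneous of degree `0`, so its gradient has degree `-1`. -/
theorem gradient_rayExtension_exp_smul {n : ℕ} (φ : S n → ℝ) (s : ℝ) (ξ : S n) :
    gradient (rayExtension φ) (Real.exp s • (ξ : E n)) =
      Real.exp (-s) • sphericalGradient φ ξ := by
  have h : (fun x : E n => rayExtension φ (Real.exp s • x)) = rayExtension φ :=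
    funext fun x => rayExtension_pos_smul φ (Real.exp_pos s) x
  have h2 : fderiv ℝ (rayExtension φ) (ξ : E n) =
      Real.exp s • fderiv ℝ (rayExtension φ) (Real.exp s • (ξ : E n)) := by
    conv_lhs => rw [← h]
    exact fderiv_comp_smul _
  rw [sphericalGradient, gradient, gradient, h2, map_smul, smul_smul, ← Real.exp_add,
    neg_add_cancel, Real.exp_zero, one_smul]

theorem inner_sphericalGradient_self {n : ℕ} {φ : S n → ℝ}
    (hφ : ContDiffOn ℝ ∞ (rayExtension φ) {0}ᶜ) (ξ : S n) :
    inner ℝ (sphericalGradient φ ξ) (ξ : E n) = 0 := by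
  have h1 : HasFDerivAt (rayExtension φ) (InnerProductSpace.toDual ℝ _ (sphericalGradient φ ξ))
      ((1 : ℝ) • (ξ : E n)) := by
    rw [one_smul]
    exact (differentiableAt_rayExtension hφ (ne_zero_of_mem_unit_sphere ξ)).hasGradientAt
  have h2 : HasDerivAt (fun t : ℝ => t • (ξ : E n)) (ξ : E n) 1 := by
    simpa using (hasDerivAt_id (1 : ℝ)).smul_const (ξ : E n)
  have h3 := h1.comp_hasDerivAt (1 : ℝ) h2
  have h4 : HasDerivAt (rayExtension φ ∘ fun t : ℝ => t • (ξ : E n)) 0 1 := by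
    refine (hasDerivAt_const (1 : ℝ) (φ ξ)).congr_of_eventuallyEq ?_
    filter_upwards [lt_mem_nhds (zero_lt_one : (0 : ℝ) < 1)] with t ht
    rw [Function.comp_apply, rayExtension_pos_smul φ ht, rayExtension_coe]
  exact h3.unique h4

theorem hasGradientAt_logProduct {n : ℕ} {w : ℝ → ℝ} (hw : Differentiable ℝ w) {φ : S n → ℝ}
    (hφ : ContDiffOn ℝ ∞ (rayExtension φ) {0}ᶜ) (s : ℝ) (ξ : S n) :
    HasGradientAt (logProduct w φ)
      (Real.exp (-s) • ((deriv w s * φ ξ) • (ξ : E n) + w s • sphericalGradient φ ξ))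
      (Real.exp s • (ξ : E n)) := by
  set x : E n := Real.exp s • (ξ : E n) with hx
  have hx0 : x ≠ 0 := exp_smul_ne_zero s ξ
  have hlog : Real.log ‖x‖ = s := by rw [hx, norm_exp_smul, Real.log_exp]
  have h1 : HasFDerivAt (fun y : E n => Real.log ‖y‖)
      (InnerProductSpace.toDual ℝ _ (Real.exp (-s) • (ξ : E n))) x := by
    -- Differentiates `log |y|` as `½ log |y|²`.
    have h := ((hasStrictFDerivAt_norm_sq x).hasFDerivAt.log
      (pow_ne_zero 2 (norm_ne_zero_iff.2 hx0))).const_mul (1 / 2)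
    refine (h.congr_fderiv ?_).congr_of_eventuallyEq (Filter.Eventually.of_forall fun y => ?_)
    · ext v
      simp only [hx, norm_exp_smul, Real.exp_neg, smul_apply, map_smul,
        InnerProductSpace.toDual_apply_apply, innerSL_apply_apply, smul_eq_mul, nsmul_eq_mul, Nat.cast_ofNat]
      have := (Real.exp_pos s).ne'
      field_simp
    · simp only [Real.log_pow]
      push_cast
      ring
  have h2 : HasFDerivAt (rayExtension φ)
      (InnerProductSpace.toDual ℝ _ (Real.exp (-s) • sphericalGradient φ ξ)) x := by
    rw [← gradient_rayExtension_exp_smul]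
    exact (differentiableAt_rayExtension hφ hx0).hasGradientAt
  have h3 : HasDerivAt w (deriv w s) (Real.log ‖x‖) := by
    rw [hlog]
    exact (hw s).hasDerivAt
  rw [hasGradientAt_iff_hasFDerivAt]
  refine ((h3.comp_hasFDerivAt x h1).mul h2).congr_fderiv ?_
  rw [Function.comp_apply, hlog, hx, rayExtension_exp_smul]
  simp only [map_add, map_smul, smul_smul, smul_add]
  rw [add_comm]
  congr 2 <;> ring

/-- Pythagoras: the radial and tangential parts are orthogonal, so no cross term appears. -/
theorem norm_sq_gradient_logProduct {n : ℕ} {w : ℝ → ℝ} (hw : Differentiable ℝ w) {φ : S n → ℝ}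
    (hφ : ContDiffOn ℝ ∞ (rayExtension φ) {0}ᶜ) (s : ℝ) (ξ : S n) :
    ‖gradient (logProduct w φ) (Real.exp s • (ξ : E n))‖ ^ 2 =
      Real.exp (-s) ^ 2 * (deriv w s ^ 2 * φ ξ ^ 2 + w s ^ 2 * ‖sphericalGradient φ ξ‖ ^ 2) := by
  rw [(hasGradientAt_logProduct hw hφ s ξ).gradient, norm_smul, mul_pow, Real.norm_eq_abs,
    sq_abs, norm_add_sq_real, norm_smul, norm_smul, inner_smul_left, inner_smul_right,
    real_inner_comm, inner_sphericalGradient_self hφ, norm_eq_of_mem_sphere ξ]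
  simp only [mul_pow, Real.norm_eq_abs, sq_abs]
  ring

/-! ### Energy and Hardy term of a separated function -/

theorem hasCompactSupport_sq {X : Type*} [TopologicalSpace X] {w : X → ℝ}
    (hw : HasCompactSupport w) : HasCompactSupport fun s => w s ^ 2 :=
  hw.comp_left (g := (· ^ 2)) (zero_pow two_ne_zero)

theorem energy_eq_of_support {n : ℕ} {U : Set (E n)} {u : E n → ℝ} (hu : tsupport u ⊆ U) :
    energy U u = ∫ x, ‖gradient u x‖ ^ 2 := by
  refine setIntegral_eq_integral_of_forall_compl_eq_zero fun x hx => ?_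
  have h : u =ᶠ[nhds x] 0 := notMem_tsupport_iff_eventuallyEq.1 fun h => hx (hu h)
  rw [h.gradient_eq]
  have : gradient (0 : E n → ℝ) x = 0 := gradient_fun_const x (0 : ℝ)
  rw [this, norm_zero, zero_pow two_ne_zero]

theorem hardyTerm_eq_of_support {n : ℕ} {U : Set (E n)} {u : E n → ℝ} (hu : tsupport u ⊆ U) :
    hardyTerm U u = ∫ x, u x ^ 2 / ‖x‖ ^ 2 := by
  refine setIntegral_eq_integral_of_forall_compl_eq_zero fun x hx => ?_
  rw [image_eq_zero_of_notMem_tsupport fun h => hx (hu h)]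
  simp

theorem ae_exists_exp_smul {n : ℕ} (hn : 2 ≤ n) :
    ∀ᵐ x : E n, ∃ (s : ℝ) (ξ : S n), x = Real.exp s • (ξ : E n) := by
  have : Nontrivial (E n) := Module.nontrivial_of_finrank_pos (R := ℝ) (by simp; omega)
  filter_upwards [Measure.ae_ne volume (0 : E n)] with x hx using exists_exp_smul hx

theorem integral_norm_sq_gradient_logProduct {n : ℕ} (hn : 2 ≤ n) {w : ℝ → ℝ}
    (hw : HasCompactSupport w) (hws : ContDiff ℝ ∞ w) {φ : S n → ℝ}
    (hφ : ContDiffOn ℝ ∞ (rayExtension φ) {0}ᶜ) :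
    ∫ x, ‖gradient (logProduct w φ) x‖ ^ 2 =
      (∫ s, deriv w s ^ 2 * Real.exp ((n - 2) * s)) *
          (∫ ξ, φ ξ ^ 2 ∂(volume : Measure (E n)).toSphere) +
        (∫ s, w s ^ 2 * Real.exp ((n - 2) * s)) *
          ∫ ξ, ‖sphericalGradient φ ξ‖ ^ 2 ∂(volume : Measure (E n)).toSphere := by
  have hd : Continuous (deriv w) := hws.continuous_deriv (by simp)
  have hφc := continuous_of_contDiffOn_rayExtension hφ
  have hgc := continuous_sphericalGradient hφ
  have hwc := hws.continuous
  let a₁ : ℝ → ℝ := fun s => deriv w s ^ 2 * Real.exp (-s) ^ 2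
  let a₂ : ℝ → ℝ := fun s => w s ^ 2 * Real.exp (-s) ^ 2
  let b₁ : S n → ℝ := fun ξ => φ ξ ^ 2
  let b₂ : S n → ℝ := fun ξ => ‖sphericalGradient φ ξ‖ ^ 2
  have i₁ : Integrable (logProduct a₁ b₁) := integrable_logProduct
    (hasCompactSupport_sq hw.deriv).mul_right (by fun_prop) (by fun_prop)
  have i₂ : Integrable (logProduct a₂ b₂) := integrable_logProduct
    (hasCompactSupport_sq hw).mul_right (by fun_prop) (by fun_prop)
  have key : ∫ x, ‖gradient (logProduct w φ) x‖ ^ 2 =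
      ∫ x, (logProduct a₁ b₁ x + logProduct a₂ b₂ x) := by
    refine integral_congr_ae ?_
    filter_upwards [ae_exists_exp_smul hn] with x hx
    obtain ⟨s, ξ, rfl⟩ := hx
    rw [norm_sq_gradient_logProduct (hws.differentiable (by simp)) hφ, logProduct_exp_smul,
      logProduct_exp_smul]
    ring
  have hexp (s : ℝ) : Real.exp (-s) ^ 2 * Real.exp (n * s) = Real.exp ((n - 2) * s) := by
    rw [← Real.exp_nat_mul, ← Real.exp_add]
    congr 1
    push_cast
    ring
  rw [key, integral_add i₁ i₂]
  rw [integral_logProduct hn, integral_logProduct hn]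
  simp only [a₁, a₂, b₁, b₂, mul_assoc, hexp]

theorem integral_logProduct_sq_div {n : ℕ} (hn : 2 ≤ n) (w : ℝ → ℝ) (φ : S n → ℝ) :
    ∫ x, logProduct w φ x ^ 2 / ‖x‖ ^ 2 =
      (∫ s, w s ^ 2 * Real.exp ((n - 2) * s)) *
          (∫ ξ, φ ξ ^ 2 ∂(volume : Measure (E n)).toSphere) := by
  have key : ∫ x, logProduct w φ x ^ 2 / ‖x‖ ^ 2 =
      ∫ x, logProduct (fun s => w s ^ 2 * Real.exp (-s) ^ 2) (fun ξ => φ ξ ^ 2) x := by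
    refine integral_congr_ae ?_
    filter_upwards [ae_exists_exp_smul hn] with x hx
    obtain ⟨s, ξ, rfl⟩ := hx
    rw [logProduct_exp_smul, logProduct_exp_smul, norm_exp_smul, Real.exp_neg]
    field_simp
  have hexp (s : ℝ) : Real.exp (-s) ^ 2 * Real.exp (n * s) = Real.exp ((n - 2) * s) := by
    rw [← Real.exp_nat_mul, ← Real.exp_add]
    congr 1
    push_cast
    ring
  rw [key, integral_logProduct hn]
  simp only [mul_assoc, hexp]

/-! ### Divergence theorem on the sphere -/

theorem integral_fderiv_eq_zero_of_hasCompactSupport {F : Type*} [NormedAddCommGroup F]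
    [NormedSpace ℝ F] [FiniteDimensional ℝ F] [MeasurableSpace F] [BorelSpace F]
    (μ : Measure F) [μ.IsAddHaarMeasure] {f : F → ℝ} (hf : ContDiff ℝ ∞ f)
    (hc : HasCompactSupport f) (v : F) : ∫ x, fderiv ℝ f x v ∂μ = 0 := by
  have hi : Integrable (fun x => fderiv ℝ f x v) μ :=
    ((hf.continuous_fderiv (by simp)).clm_apply continuous_const).integrable_of_hasCompactSupport
      (hc.fderiv_apply (𝕜 := ℝ) v)
  have h := integral_mul_fderiv_eq_neg_fderiv_mul_of_integrable (𝕜 := ℝ) (μ := μ)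
    (f := fun _ => (1 : ℝ)) (g := f) (v := v) (by simp) (by simpa using hi)
    (by simpa using hf.continuous.integrable_of_hasCompactSupport hc)
    (fun x _ => differentiableAt_const _) (fun x _ => hf.differentiable (by simp) x)
  simpa using h

/-- The divergence theorem on the sphere for the tangential part of a constant vector field. -/
theorem integral_inner_sphericalGradient {n : ℕ} (hn : 2 ≤ n) {φ : S n → ℝ}
    (hφ : ContDiffOn ℝ ∞ (rayExtension φ) {0}ᶜ) (e : E n) :
    ∫ ξ, inner ℝ (sphericalGradient φ ξ) e ∂(volume : Measure (E n)).toSphere =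
      (n - 1) * ∫ ξ, inner ℝ (ξ : E n) e * φ ξ ∂(volume : Measure (E n)).toSphere := by
  let η : ContDiffBump (0 : ℝ) := default
  -- The identity comes from `∫ ∂_e u = 0` for `u` the separated function of `w` and `φ`. The
  -- exponent `1 - n` cancels the weight `e^{-s} e^{ns}`, leaving `∫ (η' + (1 - n) η) = (1 - n) ∫ η`
  -- as radial factor.
  let w : ℝ → ℝ := fun s => η s * Real.exp ((1 - n) * s)
  have hη : ContDiff ℝ ∞ (η : ℝ → ℝ) := η.contDiff
  have hws : ContDiff ℝ ∞ w := hη.mul (by fun_prop)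
  have hw : HasCompactSupport w := η.hasCompactSupport.mul_right
  have hd : Continuous (deriv w) := hws.continuous_deriv (by simp)
  have hφc := continuous_of_contDiffOn_rayExtension hφ
  have hgc := continuous_sphericalGradient hφ
  have hwc := hws.continuous
  let a₁ : ℝ → ℝ := fun s => deriv w s * Real.exp (-s)
  let a₂ : ℝ → ℝ := fun s => w s * Real.exp (-s)
  let b₁ : S n → ℝ := fun ξ => inner ℝ (ξ : E n) e * φ ξ
  let b₂ : S n → ℝ := fun ξ => inner ℝ (sphericalGradient φ ξ) e
  have i₁ : Integrable (logProduct a₁ b₁) := integrable_logProduct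
    hw.deriv.mul_right (by fun_prop) (by fun_prop)
  have i₂ : Integrable (logProduct a₂ b₂) := integrable_logProduct
    hw.mul_right (by fun_prop) (by fun_prop)
  have key : ∫ x, fderiv ℝ (logProduct w φ) x e =
      ∫ x, (logProduct a₁ b₁ x + logProduct a₂ b₂ x) := by
    refine integral_congr_ae ?_
    filter_upwards [ae_exists_exp_smul hn] with x hx
    obtain ⟨s, ξ, rfl⟩ := hx
    rw [(hasGradientAt_logProduct (hws.differentiable (by simp)) hφ s ξ).hasFDerivAt.fderiv,
      logProduct_exp_smul, logProduct_exp_smul, InnerProductSpace.toDual_apply_apply,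
      inner_smul_left, inner_add_left, inner_smul_left, inner_smul_left]
    simp only [a₁, a₂, b₁, b₂, conj_trivial]
    ring
  have h2 (s : ℝ) : Real.exp ((1 - n) * s) * Real.exp (-s) * Real.exp (n * s) = 1 := by
    rw [← Real.exp_add, ← Real.exp_add, Real.exp_eq_one_iff]
    ring
  have hη' (s : ℝ) : deriv w s * Real.exp (-s) * Real.exp (n * s) =
      deriv η s + (1 - n) * η s := by
    have h : HasDerivAt w (deriv η s * Real.exp ((1 - n) * s) +
        η s * (Real.exp ((1 - n) * s) * ((1 - n) * 1))) s :=
      (hη.differentiable (by simp) s).hasDerivAt.mul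
        (((hasDerivAt_id s).const_mul _).exp)
    rw [h.deriv]
    linear_combination (deriv η s + (1 - n) * η s) * h2 s
  have hη'' (s : ℝ) : w s * Real.exp (-s) * Real.exp (n * s) = η s := by
    linear_combination η s * h2 s
  have hηi : Integrable (η : ℝ → ℝ) :=
    hη.continuous.integrable_of_hasCompactSupport η.hasCompactSupport
  have hηd : Integrable (deriv (η : ℝ → ℝ)) :=
    (hη.continuous_deriv (by simp)).integrable_of_hasCompactSupport η.hasCompactSupport.deriv
  have hη0 : ∫ s, deriv (η : ℝ → ℝ) s = 0 := by
    simpa using integral_fderiv_eq_zero_of_hasCompactSupport volume hη η.hasCompactSupport 1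
  rw [integral_fderiv_eq_zero_of_hasCompactSupport volume (contDiff_logProduct hw hws hφ)
    (hasCompactSupport_logProduct hw φ), integral_add i₁ i₂] at key
  rw [integral_logProduct hn, integral_logProduct hn] at key
  simp only [a₁, a₂, b₁, b₂, hη', hη''] at key
  rw [integral_add hηd (hηi.const_mul _), hη0, integral_const_mul] at key
  have hpos : 0 < ∫ s, η s := η.integral_pos
  apply mul_left_cancel₀ hpos.ne'
  linear_combination -key

/-! ### Convex profiles -/

/-- A smooth convex nonincreasing function that vanishes on a neighbourhood of `[c, ∞)` and whose
tangent lines are nonnegative at `0`. -/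
structure IsConvexProfile (c : ℝ) (g : ℝ → ℝ) : Prop where
  smooth : ContDiff ℝ ∞ g
  nonneg : ∀ t, 0 ≤ g t
  convex : ∀ t, 0 ≤ deriv (deriv g) t
  mul_deriv_le : ∀ t, t * deriv g t ≤ g t
  pos : ∀ t ≤ 0, 0 < g t
  mul_deriv_lt : ∀ t ≤ 0, t * deriv g t < g t
  eq_zero : ∃ d < c, ∀ t, d ≤ t → g t = 0

/-- The profile is `∫_t^c h` for a nonincreasing cutoff `h` that is `1` up to `c/3` and `0` from
`2c/3` on. It has slope `-1` for `t ≤ 0`, which gives the strict inequality there; for `t ≥ 0` the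
signs `t g' ≤ 0 ≤ g` suffice. -/
theorem exists_isConvexProfile {c : ℝ} (hc : 0 < c) : ∃ g, IsConvexProfile c g := by
  let h : ℝ → ℝ := fun s => Real.smoothTransition (2 - 3 / c * s)
  have hs : ContDiff ℝ ∞ h := Real.smoothTransition.contDiff.comp (by fun_prop)
  have hcont : Continuous h := hs.continuous
  have h0 (s : ℝ) : 0 ≤ h s := Real.smoothTransition.nonneg _
  have h_one (s : ℝ) (hsc : s ≤ c / 3) : h s = 1 := by
    refine Real.smoothTransition.one_of_one_le ?_
    have : 3 / c * s ≤ 3 / c * (c / 3) := by gcongr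
    have h3 : 3 / c * (c / 3) = 1 := by field_simp
    linarith
  have h_zero (s : ℝ) (hsc : 2 * c / 3 ≤ s) : h s = 0 := by
    refine Real.smoothTransition.zero_of_nonpos ?_
    have : 3 / c * (2 * c / 3) ≤ 3 / c * s := by gcongr
    have h3 : 3 / c * (2 * c / 3) = 2 := by field_simp
    linarith
  have hanti : Antitone h := fun x y hxy => by
    refine Real.smoothTransition.monotone ?_
    have : 3 / c * x ≤ 3 / c * y := by gcongr
    linarith
  let g : ℝ → ℝ := fun t => ∫ s in t..c, h s
  have hg (t : ℝ) : HasDerivAt g (-h t) t :=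
    intervalIntegral.integral_hasDerivAt_left (hcont.intervalIntegrable _ _)
      hcont.stronglyMeasurable.stronglyMeasurableAtFilter hcont.continuousAt
  have hgd : deriv g = fun t => -h t := funext fun t => (hg t).deriv
  have hg_zero (t : ℝ) (ht : 2 * c / 3 ≤ t) : g t = 0 := by
    refine intervalIntegral.integral_zero_ae (Filter.Eventually.of_forall fun s hsm => ?_)
    refine h_zero s ?_
    have : min t c < s := hsm.1
    rcases min_lt_iff.1 this with h | h <;> linarith
  have hg_nonneg (t : ℝ) : 0 ≤ g t := by
    rcases le_total t c with htc | htc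
    · exact intervalIntegral.integral_nonneg htc fun s _ => h0 s
    · rw [hg_zero t (by linarith)]
  have hg_anti : Antitone g := antitone_of_deriv_nonpos (fun t => (hg t).differentiableAt)
    fun t => by rw [(hg t).deriv]; linarith [h0 t]
  have hg_pos0 : 0 < g 0 := by
    have h1 : ∫ s in (0 : ℝ)..(c / 3), h s = c / 3 := by
      rw [intervalIntegral.integral_congr (g := fun _ => (1 : ℝ))]
      · simp
      · intro s hsm
        rw [uIcc_of_le (by positivity)] at hsm
        exact h_one s hsm.2
    have h2 : g 0 = (∫ s in (0 : ℝ)..(c / 3), h s) + g (c / 3) :=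
      (intervalIntegral.integral_add_adjacent_intervals (hcont.intervalIntegrable _ _)
        (hcont.intervalIntegrable _ _)).symm
    have := hg_nonneg (c / 3)
    rw [h2, h1]
    positivity
  have hg_affine (t : ℝ) (ht : t ≤ 0) : g t = g 0 - t := by
    have h1 : ∫ s in t..0, h s = -t := by
      rw [intervalIntegral.integral_congr (g := fun _ => (1 : ℝ))]
      · simp
      · intro s hsm
        rw [uIcc_of_le ht] at hsm
        exact h_one s (by linarith [hsm.2])
    have h2 : g t = (∫ s in t..0, h s) + g 0 :=
      (intervalIntegral.integral_add_adjacent_intervals (hcont.intervalIntegrable _ _)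
        (hcont.intervalIntegrable _ _)).symm
    rw [h2, h1]
    ring
  have hlt (t : ℝ) (ht : t ≤ 0) : t * deriv g t < g t := by
    rw [(hg t).deriv, hg_affine t ht, h_one t (by linarith)]
    linarith
  refine ⟨g, ?_, hg_nonneg, fun t => ?_, fun t => ?_, fun t ht => ?_, hlt,
    2 * c / 3, by linarith, hg_zero⟩
  · rw [contDiff_infty_iff_deriv]
    exact ⟨fun t => (hg t).differentiableAt, hgd ▸ hs.neg⟩
  · rw [hgd]
    have hm : Monotone fun t => -h t := fun x y hxy => neg_le_neg (hanti hxy)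
    exact hm.deriv_nonneg
  · rcases le_total t 0 with ht | ht
    · exact (hlt t ht).le
    · rw [(hg t).deriv]
      nlinarith [h0 t, hg_nonneg t]
  · exact hg_pos0.trans_le (hg_anti ht)

/-! ### The eigenvalue of the cap -/

theorem apply_last_sq_add_normPrime_sq {n : ℕ} (hn : 2 ≤ n) (ξ : S n) :
    (ξ : E n) (last n hn) ^ 2 + normPrime hn (ξ : E n) ^ 2 = 1 := by
  rw [normPrime, Real.sq_sqrt (Finset.sum_nonneg fun i _ => sq_nonneg _),
    Finset.add_sum_erase Finset.univ (fun i => (ξ : E n) i ^ 2) (Finset.mem_univ _),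
    ← EuclideanSpace.real_norm_sq_eq, norm_eq_of_mem_sphere ξ, one_pow]

/-- On the unit sphere `|ξ'|² = 1 - ξ_n²`, so the cone condition becomes a bound on the height
alone. -/
theorem mem_sphericalCap_iff {n : ℕ} (hn : 2 ≤ n) {θ : ℝ} (hθ : θ ∈ Ioo 0 (Real.pi / 2))
    (ξ : S n) : ξ ∈ sphericalCap n hn θ ↔ (ξ : E n) (last n hn) < Real.cos θ := by
  have hs : 0 < Real.sin θ := Real.sin_pos_of_pos_of_lt_pi hθ.1 (by linarith [hθ.2, Real.pi_pos])
  have hc : 0 < Real.cos θ := Real.cos_pos_of_mem_Ioo ⟨by linarith [hθ.1, Real.pi_pos], hθ.2⟩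
  have h1 := Real.sin_sq_add_cos_sq θ
  have h2 := apply_last_sq_add_normPrime_sq hn ξ
  have hp : 0 ≤ normPrime hn (ξ : E n) := Real.sqrt_nonneg _
  rw [sphericalCap, mem_ofPred_eq, Real.cot_eq_cos_div_sin, div_mul_eq_mul_div, lt_div_iff₀ hs]
  generalize (ξ : E n) (last n hn) = t at *
  generalize normPrime hn (ξ : E n) = p at *
  constructor
  · intro h
    by_contra! hct
    have : p ≤ Real.sin θ := abs_le_of_sq_le_sq' (by nlinarith) hs.le |>.2
    nlinarith
  · intro h
    rcases lt_or_ge t 0 with ht | ht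
    · nlinarith [mul_nonneg hc.le hp]
    · have : Real.sin θ < p := lt_of_pow_lt_pow_left₀ 2 hp (by nlinarith)
      nlinarith

/-- The function `ξ ↦ G (ξ_n)` on the sphere. -/
def zonal {n : ℕ} (hn : 2 ≤ n) (G : ℝ → ℝ) (ξ : S n) : ℝ := G ((ξ : E n) (last n hn))

theorem rayExtension_zonal {n : ℕ} (hn : 2 ≤ n) (G : ℝ → ℝ) {x : E n} (hx : x ≠ 0) :
    rayExtension (zonal hn G) x = G (‖x‖⁻¹ * x (last n hn)) := by
  rw [rayExtension, dif_neg hx]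
  rfl

theorem contDiffOn_rayExtension_zonal {n : ℕ} (hn : 2 ≤ n) {G : ℝ → ℝ} (hG : ContDiff ℝ ∞ G) :
    ContDiffOn ℝ ∞ (rayExtension (zonal hn G)) {0}ᶜ := by
  have h : ContDiffOn ℝ ∞ (fun x : E n => G (‖x‖⁻¹ * x (last n hn))) {0}ᶜ := by
    refine hG.comp_contDiffOn fun x hx => ?_
    have hx' : x ≠ 0 := hx
    have h1 : ContDiffAt ℝ ∞ (fun x : E n => x (last n hn)) x :=
      (EuclideanSpace.proj (𝕜 := ℝ) (last n hn)).contDiff.contDiffAt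
    exact (((contDiffAt_norm ℝ hx').inv (norm_ne_zero_iff.2 hx')).mul h1).contDiffWithinAt
  exact h.congr fun x hx => rayExtension_zonal hn G hx

theorem sphericalGradient_zonal {n : ℕ} (hn : 2 ≤ n) {G : ℝ → ℝ} (hG : Differentiable ℝ G)
    (ξ : S n) : sphericalGradient (zonal hn G) ξ =
      deriv G ((ξ : E n) (last n hn)) •
        (eLast n hn - (ξ : E n) (last n hn) • (ξ : E n)) := by
  have hξ : (ξ : E n) ≠ 0 := ne_zero_of_mem_unit_sphere ξ
  have hn1 : ‖(ξ : E n)‖ = 1 := norm_eq_of_mem_sphere ξ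
  have h1 : HasFDerivAt (fun x : E n => x (last n hn))
      (EuclideanSpace.proj (𝕜 := ℝ) (last n hn)) (ξ : E n) :=
    (EuclideanSpace.proj (𝕜 := ℝ) (last n hn)).hasFDerivAt
  have h2 : HasFDerivAt (fun x : E n => ‖x‖⁻¹) (-(innerSL ℝ (ξ : E n))) (ξ : E n) := by
    have h := (hasStrictFDerivAt_norm_sq (ξ : E n)).hasFDerivAt.sqrt
      (pow_ne_zero 2 (norm_ne_zero_iff.2 hξ))
    simp only [Real.sqrt_sq (norm_nonneg _)] at h
    refine ((hasDerivAt_inv (norm_ne_zero_iff.2 hξ)).comp_hasFDerivAt (ξ : E n) h).congr_fderiv ?_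
    ext v
    simp [hn1]
  have h3 : HasDerivAt G (deriv G ((ξ : E n) (last n hn)))
      (‖(ξ : E n)‖⁻¹ * (ξ : E n) (last n hn)) := by
    rw [hn1, inv_one, one_mul]
    exact (hG _).hasDerivAt
  refine HasGradientAt.gradient ?_
  rw [hasGradientAt_iff_hasFDerivAt]
  refine ((h3.comp_hasFDerivAt (ξ : E n) (h2.mul h1)).congr_fderiv ?_).congr_of_eventuallyEq ?_
  · ext v
    simp [hn1, eLast, EuclideanSpace.inner_single_left]
    ring
  · filter_upwards [isOpen_compl_singleton.mem_nhds hξ] with x hx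
    exact rayExtension_zonal hn G hx

theorem inner_eLast {n : ℕ} (hn : 2 ≤ n) (x : E n) : inner ℝ x (eLast n hn) = x (last n hn) := by
  simp [eLast, EuclideanSpace.inner_single_right]

theorem norm_eLast {n : ℕ} (hn : 2 ≤ n) : ‖eLast n hn‖ = 1 := by
  simp [eLast]

theorem eLast_apply_last {n : ℕ} (hn : 2 ≤ n) : eLast n hn (last n hn) = 1 := by
  simp [eLast]

theorem inner_sphericalGradient_zonal_eLast {n : ℕ} (hn : 2 ≤ n) {G : ℝ → ℝ}
    (hG : Differentiable ℝ G) (ξ : S n) :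
    inner ℝ (sphericalGradient (zonal hn G) ξ) (eLast n hn) =
      deriv G ((ξ : E n) (last n hn)) * (1 - (ξ : E n) (last n hn) ^ 2) := by
  rw [sphericalGradient_zonal hn hG, inner_smul_left, inner_sub_left, inner_smul_left,
    inner_eLast, inner_eLast, eLast_apply_last]
  simp only [conj_trivial]
  ring

theorem norm_sq_sphericalGradient_zonal {n : ℕ} (hn : 2 ≤ n) {G : ℝ → ℝ}
    (hG : Differentiable ℝ G) (ξ : S n) :
    ‖sphericalGradient (zonal hn G) ξ‖ ^ 2 =
      deriv G ((ξ : E n) (last n hn)) ^ 2 * (1 - (ξ : E n) (last n hn) ^ 2) := by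
  rw [sphericalGradient_zonal hn hG, norm_smul, mul_pow, norm_sub_sq_real, norm_smul,
    inner_smul_right, real_inner_comm, inner_eLast, norm_eLast, norm_eq_of_mem_sphere ξ]
  simp only [mul_pow, Real.norm_eq_abs, sq_abs]
  ring

/-- Locality is transferred from `ℝⁿ`: multiplied by a radial bump equal to `1` at `s = 0`, the ray
extension vanishes near `ξ`. -/
theorem sphericalGradient_eq_zero_of_notMem_tsupport {n : ℕ} {φ : S n → ℝ}
    (hφ : ContDiffOn ℝ ∞ (rayExtension φ) {0}ᶜ) {ξ : S n} (hξ : ξ ∉ tsupport φ) :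
    sphericalGradient φ ξ = 0 := by
  let η : ContDiffBump (0 : ℝ) := default
  have h1 : Real.exp 0 • (ξ : E n) ∉ tsupport (logProduct (η : ℝ → ℝ) φ) := fun h => by
    obtain ⟨⟨s, ζ⟩, hp, he⟩ := tsupport_logProduct_subset η.hasCompactSupport φ h
    have hs : s = 0 := by
      have := congrArg norm he
      simpa only [norm_exp_smul, Real.exp_eq_exp] using this
    subst hs
    have : ζ = ξ := by
      ext1
      simpa using he
    exact hξ (this ▸ hp.2)
  have h2 := hasGradientAt_logProduct ((η.contDiff (n := 1)).differentiable (by simp)) hφ 0 ξ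
  have h3 := (notMem_tsupport_iff_eventuallyEq.1 h1).gradient_eq
  have h4 : gradient (0 : E n → ℝ) (Real.exp 0 • (ξ : E n)) = 0 := gradient_fun_const _ (0 : ℝ)
  rw [h4, h2.gradient, image_eq_zero_of_notMem_tsupport hξ] at h3
  have h5 : η 0 = 1 := η.one_of_mem_closedBall (mem_closedBall_self η.rIn_pos.le)
  simpa [h5] using h3

theorem setIntegral_sphericalGradient_of_support {n : ℕ} {U : Set (S n)} {φ : S n → ℝ}
    (hφ : IsSphericalTestFunction U φ) (μ : Measure (S n)) :
    ∫ ξ in U, ‖sphericalGradient φ ξ‖ ^ 2 ∂μ = ∫ ξ, ‖sphericalGradient φ ξ‖ ^ 2 ∂μ := by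
  refine setIntegral_eq_integral_of_forall_compl_eq_zero fun ξ hξ => ?_
  rw [sphericalGradient_eq_zero_of_notMem_tsupport hφ.smooth fun h => hξ (hφ.support_subset h)]
  simp

theorem setIntegral_sq_of_support {n : ℕ} {U : Set (S n)} {φ : S n → ℝ}
    (hφ : IsSphericalTestFunction U φ) (μ : Measure (S n)) :
    ∫ ξ in U, φ ξ ^ 2 ∂μ = ∫ ξ, φ ξ ^ 2 ∂μ := by
  refine setIntegral_eq_integral_of_forall_compl_eq_zero fun ξ hξ => ?_
  rw [image_eq_zero_of_notMem_tsupport fun h => hξ (hφ.support_subset h)]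
  simp

theorem integrable_sphere {n : ℕ} {f : S n → ℝ} (hf : Continuous f) :
    Integrable f (volume : Measure (E n)).toSphere :=
  hf.integrable_of_hasCompactSupport (.of_compactSpace f)

theorem integral_sphere_pos {n : ℕ} {f : S n → ℝ} (hf : Continuous f) (h0 : ∀ ξ, 0 ≤ f ξ)
    {ξ : S n} (hξ : f ξ ≠ 0) : 0 < ∫ ξ, f ξ ∂(volume : Measure (E n)).toSphere :=
  integral_pos_of_integrable_nonneg_nonzero hf (integrable_sphere hf) h0 hξ

/-- Take `φ = g(t)` with `t = ξ_n` and `c = cos θ > 0`. The divergence theorem for `g g'` gives `∫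
(g'² + g g'')(1 - t²) = (n - 1) ∫ t g g'`. The left side dominates `∫ |∇φ|²` by convexity; the right
side is less than `(n - 1) ∫ g²` because `t g' ≤ g`, strictly at the south pole. -/
theorem exists_cap_test_function_quotient_lt {n : ℕ} (hn : 2 ≤ n) {θ : ℝ}
    (hθ : θ ∈ Ioo 0 (Real.pi / 2)) : ∃ φ : S n → ℝ,
      IsSphericalTestFunction (sphericalCap n hn θ) φ ∧ φ ≠ 0 ∧
      (∫ ξ in sphericalCap n hn θ, ‖sphericalGradient φ ξ‖ ^ 2
        ∂(volume : Measure (E n)).toSphere) /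
      (∫ ξ in sphericalCap n hn θ, φ ξ ^ 2 ∂(volume : Measure (E n)).toSphere) < n - 1 := by
  have hc : 0 < Real.cos θ := Real.cos_pos_of_mem_Ioo ⟨by linarith [hθ.1, Real.pi_pos], hθ.2⟩
  obtain ⟨g, hg⟩ := exists_isConvexProfile hc
  obtain ⟨d, hd, hgd⟩ := hg.eq_zero
  have hgs := hg.smooth
  have hg1s : ContDiff ℝ ∞ (deriv g) := (contDiff_infty_iff_deriv.1 hgs).2
  have hg2c : Continuous (deriv (deriv g)) := hg1s.continuous_deriv (by simp)
  have hgc := hgs.continuous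
  have hg1c := hg1s.continuous
  let φ : S n → ℝ := zonal hn g
  let t : S n → ℝ := fun ξ => (ξ : E n) (last n hn)
  have htc : Continuous t := by fun_prop
  have ht (ξ : S n) : 0 ≤ 1 - t ξ ^ 2 := by
    have := apply_last_sq_add_normPrime_sq hn ξ
    simp only [t]
    nlinarith [sq_nonneg (normPrime hn (ξ : E n))]
  let south : S n := ⟨-eLast n hn, by simp [norm_eLast]⟩
  have hsouth : t south = -1 := by simp [t, south, eLast_apply_last]
  have hsmooth := contDiffOn_rayExtension_zonal hn hgs
  have htest : IsSphericalTestFunction (sphericalCap n hn θ) φ := by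
    refine ⟨hsmooth, fun ξ hξ => ?_⟩
    have : tsupport φ ⊆ {ξ | t ξ ≤ d} := closure_minimal (fun ζ hζ => by
      by_contra h
      exact hζ (hgd _ (not_le.1 h).le)) (isClosed_le htc continuous_const)
    exact (mem_sphericalCap_iff hn hθ ξ).2 ((this hξ).trans_lt hd)
  have hφpos : φ south ≠ 0 := by
    have : 0 < g (t south) := hg.pos _ (by rw [hsouth]; norm_num)
    exact this.ne'
  refine ⟨φ, htest, fun h => hφpos (congrFun h _), ?_⟩
  rw [setIntegral_sphericalGradient_of_support htest, setIntegral_sq_of_support htest]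
  have hφc : Continuous φ := hgc.comp htc
  have hD : 0 < ∫ ξ, φ ξ ^ 2 ∂(volume : Measure (E n)).toSphere :=
    integral_sphere_pos (hφc.pow 2) (fun ξ => sq_nonneg _) (pow_ne_zero 2 hφpos)
  rw [div_lt_iff₀ hD]
  have hGs : ContDiff ℝ ∞ (fun s => g s * deriv g s) := hgs.mul hg1s
  have hGd (s : ℝ) : deriv (fun s => g s * deriv g s) s =
      deriv g s ^ 2 + g s * deriv (deriv g) s := by
    rw [deriv_fun_mul (hgs.differentiable (by simp) s) (hg1s.differentiable (by simp) s)]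
    ring
  have hdiv := integral_inner_sphericalGradient hn (contDiffOn_rayExtension_zonal hn hGs)
    (eLast n hn)
  simp only [inner_sphericalGradient_zonal_eLast hn (hGs.differentiable (by simp)), hGd,
    inner_eLast] at hdiv
  have hle : ∫ ξ, ‖sphericalGradient φ ξ‖ ^ 2 ∂(volume : Measure (E n)).toSphere ≤
      ∫ ξ, (deriv g (t ξ) ^ 2 + g (t ξ) * deriv (deriv g) (t ξ)) * (1 - t ξ ^ 2)
        ∂(volume : Measure (E n)).toSphere := by
    refine integral_mono ?_ ?_ fun ξ => ?_
    · exact integrable_sphere ((continuous_sphericalGradient hsmooth).norm.pow 2)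
    · exact integrable_sphere (by fun_prop)
    · simp only [φ, norm_sq_sphericalGradient_zonal hn (hgs.differentiable (by simp))]
      exact mul_le_mul_of_nonneg_right
        (le_add_of_nonneg_right (mul_nonneg (hg.nonneg _) (hg.convex _))) (ht ξ)
  have hlt : ∫ ξ, t ξ * (g (t ξ) * deriv g (t ξ)) ∂(volume : Measure (E n)).toSphere <
      ∫ ξ, φ ξ ^ 2 ∂(volume : Measure (E n)).toSphere := by
    have hi₁ : Integrable (fun ξ => φ ξ ^ 2) (volume : Measure (E n)).toSphere :=
      integrable_sphere (hφc.pow 2)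
    have hi₂ : Integrable (fun ξ => t ξ * (g (t ξ) * deriv g (t ξ)))
        (volume : Measure (E n)).toSphere := integrable_sphere (by fun_prop)
    rw [← sub_pos, ← integral_sub hi₁ hi₂]
    have hfac (ξ : S n) : φ ξ ^ 2 - t ξ * (g (t ξ) * deriv g (t ξ)) =
        g (t ξ) * (g (t ξ) - t ξ * deriv g (t ξ)) := by
      simp only [φ, zonal, t]
      ring
    simp only [hfac]
    refine integral_sphere_pos (by fun_prop)
      (fun ξ => mul_nonneg (hg.nonneg _) (sub_nonneg.2 (hg.mul_deriv_le _))) (ξ := south) ?_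
    have h1 : t south ≤ 0 := by rw [hsouth]; norm_num
    exact mul_ne_zero (hg.pos _ h1).ne' (sub_pos.2 (hg.mul_deriv_lt _ h1)).ne'
  have hn1 : (0 : ℝ) < n - 1 := by
    have : (2 : ℝ) ≤ n := by exact_mod_cast hn
    linarith
  exact hle.trans_lt (hdiv.trans_lt (mul_lt_mul_of_pos_left hlt hn1))

theorem capEigenvalue_lt {n : ℕ} (hn : 2 ≤ n) {θ : ℝ} (hθ : θ ∈ Ioo 0 (Real.pi / 2)) :
    capEigenvalue n hn θ < n - 1 := by
  obtain ⟨φ, hφ, hφ0, hlt⟩ := exists_cap_test_function_quotient_lt hn hθ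
  refine csInf_lt_of_lt ⟨0, ?_⟩ ⟨φ, hφ, hφ0, rfl⟩ hlt
  rintro q ⟨ψ, -, -, rfl⟩
  exact div_nonneg (integral_nonneg fun _ => sq_nonneg _) (integral_nonneg fun _ => sq_nonneg _)

/-! ### The interval -/

/-- With `p = -cos T`, `p'' = -ν² p` and `q = g(p)`, one has `(q q')' = q'² + ν² (g g'' sin² T - p g
g')`. This integrates to zero since `q` vanishes at both ends; then `g'' ≥ 0` and `p g' ≤ g` give
the bound. -/
theorem integral_deriv_profile_comp_cos_le {c : ℝ} {g : ℝ → ℝ} (hg : IsConvexProfile c g)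
    {ν L : ℝ} (hL : 0 ≤ L) (hc : c ≤ -Real.cos (ν * (L / 2))) :
    ∫ s in (-L)..0, (deriv g (-Real.cos (ν * (s + L / 2))) *
        (Real.sin (ν * (s + L / 2)) * ν)) ^ 2 ≤
      ν ^ 2 * ∫ s in (-L)..0, g (-Real.cos (ν * (s + L / 2))) ^ 2 := by
  obtain ⟨d, hd, hgd⟩ := hg.eq_zero
  have hgs := hg.smooth
  have hg1s : ContDiff ℝ ∞ (deriv g) := (contDiff_infty_iff_deriv.1 hgs).2
  have hg2c : Continuous (deriv (deriv g)) := hg1s.continuous_deriv (by simp)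
  have hgc := hgs.continuous
  have hg1c := hg1s.continuous
  obtain ⟨T, hTdef⟩ : ∃ T : ℝ → ℝ, T = fun s => ν * (s + L / 2) := ⟨_, rfl⟩
  have hT (s : ℝ) : HasDerivAt T ν s := by
    simpa [hTdef] using ((hasDerivAt_id s).add_const (L / 2)).const_mul ν
  have hTc : Continuous T := by rw [hTdef]; fun_prop
  have hT0 : T 0 = ν * (L / 2) := by rw [hTdef]; ring
  have hTL : T (-L) = -(ν * (L / 2)) := by rw [hTdef]; ring
  have hTs (s : ℝ) : ν * (s + L / 2) = T s := by rw [hTdef]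
  simp only [hTs]
  let p : ℝ → ℝ := fun s => -Real.cos (T s)
  have hpc : Continuous p := by fun_prop
  have hp (s : ℝ) : HasDerivAt p (Real.sin (T s) * ν) s := by
    simpa using ((hT s).cos).fun_neg
  have hq (s : ℝ) : HasDerivAt (fun s => g (p s)) (deriv g (p s) * (Real.sin (T s) * ν)) s :=
    (hgs.differentiable (by simp) _).hasDerivAt.comp s (hp s)
  let F : ℝ → ℝ := fun s => ν * (g (p s) * deriv g (p s) * Real.sin (T s))
  let F' : ℝ → ℝ := fun s => ν ^ 2 *
    ((deriv g (p s) ^ 2 + g (p s) * deriv (deriv g) (p s)) * Real.sin (T s) ^ 2 -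
      p s * (g (p s) * deriv g (p s)))
  have hF (s : ℝ) : HasDerivAt F (F' s) s := by
    have h1 : HasDerivAt (fun s => deriv g (p s))
        (deriv (deriv g) (p s) * (Real.sin (T s) * ν)) s :=
      (hg1s.differentiable (by simp) _).hasDerivAt.comp s (hp s)
    convert! (((hq s).fun_mul h1).fun_mul (hT s).sin).const_mul ν using 1
    simp only [F', p]
    ring
  have hF'c : Continuous F' := by fun_prop
  have hFTC : ∫ s in (-L)..0, F' s = 0 := by
    rw [intervalIntegral.integral_eq_sub_of_hasDerivAt (fun s _ => hF s)
      (hF'c.intervalIntegrable _ _)]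
    simp only [F, p, hT0, hTL, Real.cos_neg, hgd _ (hd.le.trans hc)]
    ring
  have hi₁ : Continuous fun s => (deriv g (p s) * (Real.sin (T s) * ν)) ^ 2 := by fun_prop
  have hi₂ : Continuous fun s => ν ^ 2 * g (p s) ^ 2 := by fun_prop
  rw [← sub_nonpos, ← intervalIntegral.integral_const_mul, ← intervalIntegral.integral_sub
    (hi₁.intervalIntegrable _ _) (hi₂.intervalIntegrable _ _)]
  refine le_trans ?_ hFTC.le
  refine intervalIntegral.integral_mono_on (by linarith)
    ((hi₁.sub hi₂).intervalIntegrable _ _) (hF'c.intervalIntegrable _ _) fun s _ => ?_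
  have h1 : 0 ≤ g (p s) * (g (p s) - p s * deriv g (p s)) :=
    mul_nonneg (hg.nonneg _) (sub_nonneg.2 (hg.mul_deriv_le _))
  have h2 : 0 ≤ g (p s) * deriv (deriv g) (p s) * Real.sin (T s) ^ 2 :=
    mul_nonneg (mul_nonneg (hg.nonneg _) (hg.convex _)) (sq_nonneg _)
  have h3 : 0 ≤ ν ^ 2 * (g (p s) * (g (p s) - p s * deriv g (p s)) +
      g (p s) * deriv (deriv g) (p s) * Real.sin (T s) ^ 2) := by positivity
  simp only [F', p] at *
  nlinarith [h3]

/-- A frequency `ν` slightly above `π/L` makes `-cos (ν (s + L/2))` positive at both ends. The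
profile therefore vanishes near them, and cutting off to the interval keeps smoothness. The room
between `ν²` and `κ` gives the strict inequality. -/
theorem exists_interval_test_function {L κ : ℝ} (hL : 0 < L) (hκ : Real.pi / L < √κ) :
    ∃ v : ℝ → ℝ, ContDiff ℝ ∞ v ∧ HasCompactSupport v ∧ tsupport v ⊆ Ioo (-L) 0 ∧
      0 < ∫ s, v s ^ 2 ∧ ∫ s, deriv v s ^ 2 < κ * ∫ s, v s ^ 2 := by
  have hπ := Real.pi_pos
  -- `α = νL/2` is the phase at the right end: above `π/2` for `-cos α > 0`, below `√κ L/2` for `ν²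
  -- < κ`.
  obtain ⟨α, hα1, hα2⟩ : ∃ α, Real.pi / 2 < α ∧ α < min Real.pi (√κ * L / 2) := by
    refine exists_between (lt_min (by linarith) ?_)
    rw [div_lt_iff₀ hL] at hκ
    linarith
  obtain ⟨hαπ, hακ⟩ := lt_min_iff.1 hα2
  let ν : ℝ := 2 * α / L
  have hα : 0 < α := by linarith
  have hν : 0 < ν := by positivity
  have hνκ : ν ^ 2 < κ := by
    rw [← Real.lt_sqrt hν.le, div_lt_iff₀ hL]
    linarith
  have hc : 0 < -Real.cos α := by
    have := Real.cos_neg_of_pi_div_two_lt_of_lt hα1 (by linarith)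
    linarith
  obtain ⟨g, hg⟩ := exists_isConvexProfile hc
  obtain ⟨d, hd, hgd⟩ := hg.eq_zero
  have hgs := hg.smooth
  have hg1s : ContDiff ℝ ∞ (deriv g) := (contDiff_infty_iff_deriv.1 hgs).2
  have hg2c : Continuous (deriv (deriv g)) := hg1s.continuous_deriv (by simp)
  have hgc := hgs.continuous
  have hg1c := hg1s.continuous
  let T : ℝ → ℝ := fun s => ν * (s + L / 2)
  have hT (s : ℝ) : HasDerivAt T ν s := by
    simpa using ((hasDerivAt_id s).add_const (L / 2)).const_mul ν
  have hTc : Continuous T := by fun_prop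
  have hT0 : T 0 = α := by simp only [T, ν]; field_simp; ring
  have hTL : T (-L) = -α := by simp only [T, ν]; field_simp; ring
  let p : ℝ → ℝ := fun s => -Real.cos (T s)
  have hpc : Continuous p := by fun_prop
  have hp (s : ℝ) : HasDerivAt p (Real.sin (T s) * ν) s := by
    simpa using ((hT s).cos).fun_neg
  let q : ℝ → ℝ := fun s => g (p s)
  have hqs : ContDiff ℝ ∞ q := hgs.comp (by fun_prop)
  have hq (s : ℝ) : HasDerivAt q (deriv g (p s) * (Real.sin (T s) * ν)) s :=
    (hgs.differentiable (by simp) _).hasDerivAt.comp s (hp s)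
  let v : ℝ → ℝ := (Ioo (-L) 0).indicator q
  let K : Set ℝ := {s | s ∈ Icc (-L) 0 ∧ p s ≤ d}
  have hKclosed : IsClosed K := isClosed_Icc.inter (isClosed_le hpc continuous_const)
  have hK : K ⊆ Ioo (-L) 0 := by
    rintro s ⟨⟨h1, h2⟩, h3⟩
    refine ⟨h1.lt_of_ne ?_, h2.lt_of_ne ?_⟩
    · rintro rfl
      simp only [p, hTL, Real.cos_neg] at h3
      linarith
    · rintro rfl
      simp only [p, hT0] at h3
      linarith
  have htsupp : tsupport v ⊆ K := by
    refine closure_minimal (fun s hs => ?_) hKclosed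
    have hsI : s ∈ Ioo (-L) 0 := mem_of_indicator_ne_zero hs
    refine ⟨Ioo_subset_Icc_self hsI, ?_⟩
    by_contra! h
    refine hs ?_
    rw [show v s = q s from indicator_of_mem hsI q]
    exact hgd _ h.le
  have hveq {s : ℝ} (hs : s ∈ Ioo (-L) 0) : v =ᶠ[nhds s] q := by
    filter_upwards [isOpen_Ioo.mem_nhds hs] with r hr using indicator_of_mem hr q
  have hvout {s : ℝ} (hs : s ∉ Ioo (-L) 0) : v =ᶠ[nhds s] 0 :=
    notMem_tsupport_iff_eventuallyEq.1 fun h => hs (hK (htsupp h))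
  have hvs : ContDiff ℝ ∞ v := by
    rw [contDiff_iff_contDiffAt]
    intro s
    by_cases hs : s ∈ Ioo (-L) 0
    · exact hqs.contDiffAt.congr_of_eventuallyEq (hveq hs)
    · exact (contDiffAt_const (c := (0 : ℝ))).congr_of_eventuallyEq (hvout hs)
  have hvcs : HasCompactSupport v :=
    (isCompact_Icc (a := -L) (b := (0 : ℝ))).of_isClosed_subset (isClosed_tsupport v)
      ((htsupp.trans hK).trans Ioo_subset_Icc_self)
  have hint (f r : ℝ → ℝ) (hin : ∀ s ∈ Ioo (-L) 0, f s = r s) (hout : ∀ s ∉ Ioo (-L) 0, f s = 0) :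
      ∫ s, f s = ∫ s in (-L)..0, r s := by
    rw [intervalIntegral.integral_of_le (by linarith), integral_Ioc_eq_integral_Ioo,
      ← setIntegral_congr_fun measurableSet_Ioo hin]
    exact (setIntegral_eq_integral_of_forall_compl_eq_zero hout).symm
  have hv2 : ∫ s, v s ^ 2 = ∫ s in (-L)..0, q s ^ 2 :=
    hint _ _ (fun s hs => by rw [(hveq hs).eq_of_nhds])
      (fun s hs => by rw [(hvout hs).eq_of_nhds]; simp)
  have hv'2 : ∫ s, deriv v s ^ 2 =
      ∫ s in (-L)..0, (deriv g (p s) * (Real.sin (T s) * ν)) ^ 2 :=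
    hint _ _ (fun s hs => by rw [(hveq hs).deriv_eq, (hq s).deriv])
      (fun s hs => by rw [(hvout hs).deriv_eq]; simp)
  have hpos : 0 < ∫ s, v s ^ 2 := by
    have hmem : -(L / 2) ∈ Ioo (-L) 0 := ⟨by linarith, by linarith⟩
    refine integral_pos_of_integrable_nonneg_nonzero (x := -(L / 2)) (hvs.continuous.pow 2)
      ((hvs.continuous.pow 2).integrable_of_hasCompactSupport
        (hasCompactSupport_sq hvcs)) (fun s => sq_nonneg _) (pow_ne_zero 2 ?_)
    rw [(hveq hmem).eq_of_nhds]
    exact (hg.pos _ (by simp [p, T])).ne'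
  refine ⟨v, hvs, hvcs, htsupp.trans hK, hpos, lt_of_le_of_lt ?_
    (mul_lt_mul_of_pos_right hνκ hpos)⟩
  rw [hv2, hv'2]
  refine integral_deriv_profile_comp_cos_le hg hL.le ?_
  have : ν * (L / 2) = α := by
    simp only [ν]
    field_simp
  rw [this]

/-! ### The truncated cone and the test function on it -/

/-- With `r = e^s`, `|rξ - ρ e_n|² - ρ² = r (r - 2ρ ξ_n)`, which is positive as `ξ_n < cos θ` and
`2ρ cos θ < r`. -/
theorem exp_smul_mem_modelDomain {n : ℕ} (hn : 2 ≤ n) {ρ θ s : ℝ} (hρ : 0 < ρ)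
    (hθ : θ ∈ Ioo 0 (Real.pi / 2)) (hs : s ∈ Ioo (Real.log (2 * ρ * Real.cos θ)) 0) {ξ : S n}
    (hξ : ξ ∈ sphericalCap n hn θ) : Real.exp s • (ξ : E n) ∈ modelDomain n hn ρ θ := by
  have hc : 0 < Real.cos θ := Real.cos_pos_of_mem_Ioo ⟨by linarith [hθ.1, Real.pi_pos], hθ.2⟩
  have hr := Real.exp_pos s
  have hr1 : Real.exp s < 1 := Real.exp_lt_one_iff.2 hs.2
  have hr2 : 2 * ρ * Real.cos θ < Real.exp s := (Real.log_lt_iff_lt_exp (by positivity)).1 hs.1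
  have hcap := (mem_sphericalCap_iff hn hθ ξ).1 hξ
  refine ⟨?_, ?_, ?_⟩
  · rw [mem_ball_zero_iff, norm_exp_smul]
    exact hr1
  · have hp : normPrime hn (Real.exp s • (ξ : E n)) = Real.exp s * normPrime hn (ξ : E n) := by
      simp only [normPrime, PiLp.smul_apply, smul_eq_mul, mul_pow, ← Finset.mul_sum]
      rw [Real.sqrt_mul (sq_nonneg _), Real.sqrt_sq hr.le]
    rw [hp, PiLp.smul_apply, smul_eq_mul, mul_left_comm]
    exact mul_lt_mul_of_pos_left hξ hr
  · refine lt_of_pow_lt_pow_left₀ 2 (norm_nonneg _) ?_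
    rw [norm_sub_sq_real, norm_exp_smul, inner_smul_left, inner_smul_right, inner_eLast,
      norm_smul, norm_eLast, Real.norm_of_nonneg hρ.le]
    simp only [conj_trivial]
    have : ρ * (ξ : E n) (last n hn) < ρ * Real.cos θ := mul_lt_mul_of_pos_left hcap hρ
    nlinarith

theorem exists_isTestFunction_modelDomain {n : ℕ} (hn : 2 ≤ n) {ρ θ : ℝ} (hρ : 0 < ρ)
    (hθ : θ ∈ Ioo 0 (Real.pi / 2))
    (h : ρ < 1 / (2 * Real.cos θ) *
      Real.exp (-(Real.pi / √((n : ℝ) - 1 - capEigenvalue n hn θ)))) :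
    ∃ u : E n → ℝ, IsTestFunction (modelDomain n hn ρ θ) u ∧
      0 < ∫ x, u x ^ 2 / ‖x‖ ^ 2 ∧
      ∫ x, ‖gradient u x‖ ^ 2 < (n : ℝ) ^ 2 / 4 * ∫ x, u x ^ 2 / ‖x‖ ^ 2 := by
  have hc : 0 < Real.cos θ := Real.cos_pos_of_mem_Ioo ⟨by linarith [hθ.1, Real.pi_pos], hθ.2⟩
  have hlam := capEigenvalue_lt hn hθ
  set lam := capEigenvalue n hn θ with hlam_def
  have hsqrt : 0 < √((n : ℝ) - 1 - lam) := Real.sqrt_pos.2 (by linarith)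
  let L : ℝ := -Real.log (2 * ρ * Real.cos θ)
  have hL1 : Real.pi / √((n : ℝ) - 1 - lam) < L := by
    have h1 : 2 * ρ * Real.cos θ < Real.exp (-(Real.pi / √((n : ℝ) - 1 - lam))) := by
      rw [one_div_mul_eq_div, lt_div_iff₀ (by positivity)] at h
      linarith
    have h2 := (Real.log_lt_iff_lt_exp (by positivity)).2 h1
    simp only [L]
    linarith
  have hL : 0 < L := lt_trans (div_pos Real.pi_pos hsqrt) hL1
  have hL2 : Real.pi / L < √((n : ℝ) - 1 - lam) := by
    rw [div_lt_iff₀ hsqrt] at hL1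
    rw [div_lt_iff₀ hL]
    linarith
  have hL3 : lam < n - 1 - (Real.pi / L) ^ 2 := by
    have := (Real.lt_sqrt (div_pos Real.pi_pos hL).le).1 hL2
    linarith
  -- Serves only to show that the set of quotients is nonempty.
  obtain ⟨φ₀, hφ₀, hφ₀0, -⟩ := exists_cap_test_function_quotient_lt hn hθ
  rw [hlam_def, capEigenvalue, firstDirichletEigenvalue] at hL3
  obtain ⟨q, ⟨φ, hφ, hφ0, rfl⟩, hq⟩ := exists_lt_of_csInf_lt
    (by exact ⟨_, φ₀, hφ₀, hφ₀0, rfl⟩) hL3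
  rw [setIntegral_sphericalGradient_of_support hφ, setIntegral_sq_of_support hφ] at hq
  obtain ⟨ξ, hξ⟩ := Function.ne_iff.1 hφ0
  have hφc := continuous_of_contDiffOn_rayExtension hφ.smooth
  have hD : 0 < ∫ ξ, φ ξ ^ 2 ∂(volume : Measure (E n)).toSphere :=
    integral_sphere_pos (hφc.pow 2) (fun ξ => sq_nonneg _) (pow_ne_zero 2 hξ)
  set D := ∫ ξ, φ ξ ^ 2 ∂(volume : Measure (E n)).toSphere
  set N := ∫ ξ, ‖sphericalGradient φ ξ‖ ^ 2 ∂(volume : Measure (E n)).toSphere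
  have hκ : Real.pi / L < √((n : ℝ) - 1 - N / D) := by
    rw [Real.lt_sqrt (div_pos Real.pi_pos hL).le]
    linarith
  obtain ⟨v, hvs, hvc, hvL, hv0, hv⟩ := exists_interval_test_function hL hκ
  -- The factor `e^{-ms}` removes the weight `e^{(n-2)s}`, at the price of `m² ∫ v²` in the energy;
  -- the cross term is the derivative of `v²` and integrates to zero.
  let m : ℝ := (n - 2) / 2
  let w : ℝ → ℝ := fun s => v s * Real.exp (-m * s)
  have hws : ContDiff ℝ ∞ w := hvs.mul (by fun_prop)
  have hw : HasCompactSupport w := hvc.mul_right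
  have hwsupp : tsupport w ⊆ Ioo (-L) 0 := (tsupport_mul_subset_left).trans hvL
  have hexp (s : ℝ) : Real.exp (-m * s) ^ 2 * Real.exp ((n - 2) * s) = 1 := by
    rw [← Real.exp_nat_mul, ← Real.exp_add, Real.exp_eq_one_iff]
    simp only [m]
    push_cast
    ring
  have hw2 : ∫ s, w s ^ 2 * Real.exp ((n - 2) * s) = ∫ s, v s ^ 2 := by
    refine integral_congr_ae (Filter.Eventually.of_forall fun s => ?_)
    linear_combination v s ^ 2 * hexp s
  have hvd : Continuous (deriv v) := hvs.continuous_deriv (by simp)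
  have hi₁ : Integrable fun s => deriv v s ^ 2 :=
    (hvd.pow 2).integrable_of_hasCompactSupport (hasCompactSupport_sq hvc.deriv)
  have hi₂ : Integrable fun s => v s ^ 2 := (hvs.continuous.pow 2).integrable_of_hasCompactSupport
    (hasCompactSupport_sq hvc)
  have hvsq : ContDiff ℝ ∞ fun s => v s ^ 2 := hvs.pow 2
  have hvsqc : HasCompactSupport fun s => v s ^ 2 := hasCompactSupport_sq hvc
  have hi₃ : Integrable (deriv fun s => v s ^ 2) :=
    (hvsq.continuous_deriv (by simp)).integrable_of_hasCompactSupport hvsqc.deriv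
  have hw'2 : ∫ s, deriv w s ^ 2 * Real.exp ((n - 2) * s) =
      (∫ s, deriv v s ^ 2) + m ^ 2 * ∫ s, v s ^ 2 := by
    have hpt (s : ℝ) : deriv w s ^ 2 * Real.exp ((n - 2) * s) =
        deriv v s ^ 2 + m ^ 2 * v s ^ 2 - m * deriv (fun s => v s ^ 2) s := by
      have hvd := (hvs.differentiable (by simp) s).hasDerivAt
      have h1 : HasDerivAt w (deriv v s * Real.exp (-m * s) +
          v s * (Real.exp (-m * s) * (-m * 1))) s :=
        hvd.mul (((hasDerivAt_id s).const_mul _).exp)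
      rw [h1.deriv, (hvd.fun_pow 2).deriv]
      push_cast
      linear_combination (deriv v s - m * v s) ^ 2 * hexp s
    have h0 : ∫ s, deriv (fun s => v s ^ 2) s = 0 := by
      simpa using integral_fderiv_eq_zero_of_hasCompactSupport volume hvsq hvsqc 1
    simp only [hpt]
    have hi₄ : Integrable fun s => deriv v s ^ 2 + m ^ 2 * v s ^ 2 := hi₁.add (hi₂.const_mul _)
    rw [integral_sub hi₄ (hi₃.const_mul _),
      integral_add hi₁ (hi₂.const_mul _), integral_const_mul, integral_const_mul, h0]
    ring
  have hH := integral_logProduct_sq_div hn w φ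
  have hE := integral_norm_sq_gradient_logProduct hn hw hws hφ.smooth
  rw [hw2] at hH hE
  rw [hw'2] at hE
  refine ⟨logProduct w φ, ⟨contDiff_logProduct hw hws hφ.smooth, hasCompactSupport_logProduct hw φ,
    fun x hx => ?_⟩, ?_, ?_⟩
  · obtain ⟨⟨s, ζ⟩, ⟨hs, hζ⟩, rfl⟩ := tsupport_logProduct_subset hw φ hx
    refine exp_smul_mem_modelDomain hn hρ hθ ?_ (hφ.support_subset hζ)
    simpa only [L, neg_neg] using hwsupp hs
  · rw [hH]
    exact mul_pos hv0 hD
  · rw [hE, hH]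
    have h1 := mul_lt_mul_of_pos_right hv hD
    have h2 : N / D * D = N := div_mul_cancel₀ _ hD.ne'
    simp only [m]
    change _ * D + _ * N < _
    calc ((∫ s, deriv v s ^ 2) + ((n - 2) / 2) ^ 2 * ∫ s, v s ^ 2) * D + (∫ s, v s ^ 2) * N
        < (n - 1 - N / D) * (∫ s, v s ^ 2) * D + ((n - 2) / 2) ^ 2 * (∫ s, v s ^ 2) * D +
            (∫ s, v s ^ 2) * N := by linarith
      _ = n ^ 2 / 4 * ((∫ s, v s ^ 2) * D) := by
          linear_combination -(∫ s, v s ^ 2) * h2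

/-! ### Monotonicity of the Hardy constant and conclusion -/

theorem IsTestFunction.mono {n : ℕ} {U V : Set (E n)} (hUV : U ⊆ V) {u : E n → ℝ}
    (hu : IsTestFunction U u) : IsTestFunction V u :=
  ⟨hu.smooth, hu.compact, hu.support_subset.trans hUV⟩

theorem bddBelow_hardyQuotients {n : ℕ} (U : Set (E n)) :
    BddBelow {q : ℝ | ∃ u : E n → ℝ, IsTestFunction U u ∧ u ≠ 0 ∧
      q = energy U u / hardyTerm U u} := by
  refine ⟨0, ?_⟩
  rintro q ⟨u, -, -, rfl⟩
  exact div_nonneg (integral_nonneg fun _ => sq_nonneg _) (integral_nonneg fun _ => by positivity)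

/-- A larger set admits more test functions with unchanged quotients. A nonzero one on `U` is
required since `sInf ∅ = 0` in `ℝ`. -/
theorem hardyConstant_anti {n : ℕ} {U V : Set (E n)} (hUV : U ⊆ V)
    (hU : ∃ u, IsTestFunction U u ∧ u ≠ 0) : hardyConstant V ≤ hardyConstant U := by
  obtain ⟨u₀, hu₀, hu₀0⟩ := hU
  refine csInf_le_csInf (bddBelow_hardyQuotients V) ⟨_, u₀, hu₀, hu₀0, rfl⟩ ?_
  rintro q ⟨u, hu, hu0, rfl⟩
  have hV := hu.mono hUV
  refine ⟨u, hV, hu0, ?_⟩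
  rw [energy_eq_of_support hu.support_subset, energy_eq_of_support hV.support_subset,
    hardyTerm_eq_of_support hu.support_subset, hardyTerm_eq_of_support hV.support_subset]

end HardyBoundary

theorem mainTheorem12 (n : ℕ) (hn : 2 ≤ n) (ρ θ : ℝ)
    (hρ : ρ ∈ Set.Ioo (0 : ℝ) (1 / 2)) (hθ : θ ∈ Set.Ioo (0 : ℝ) (Real.pi / 2))
    (Ω : Set (HardyBoundary.E n)) (hΩo : IsOpen Ω) (hΩc : IsConnected Ω)
    (hsub : HardyBoundary.modelDomain n hn ρ θ ⊆ Ω)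
    (hball : HardyBoundary.IsLargestExteriorBallAtZero Ω (ρ • HardyBoundary.eLast n hn) ρ) :
    HardyBoundary.capEigenvalue n hn θ < (n : ℝ) - 1 ∧
    (ρ < 1 / (2 * Real.cos θ) *
          Real.exp (-(Real.pi / √((n : ℝ) - 1 - HardyBoundary.capEigenvalue n hn θ))) →
      HardyBoundary.hardyConstant Ω ≤
          HardyBoundary.hardyConstant (HardyBoundary.modelDomain n hn ρ θ) ∧
      HardyBoundary.hardyConstant (HardyBoundary.modelDomain n hn ρ θ) < (n : ℝ) ^ 2 / 4 ∧
      ∃ u : HardyBoundary.E n → ℝ, HardyBoundary.IsTestFunction Ω u ∧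
        HardyBoundary.energy Ω u < (n : ℝ) ^ 2 / 4 * HardyBoundary.hardyTerm Ω u) := by
  refine ⟨HardyBoundary.capEigenvalue_lt hn hθ, fun h => ?_⟩
  obtain ⟨u, hu, hpos, hlt⟩ := HardyBoundary.exists_isTestFunction_modelDomain hn hρ.1 hθ h
  have hu0 : u ≠ 0 := by
    rintro rfl
    simp at hpos
  have huΩ := hu.mono hsub
  refine ⟨HardyBoundary.hardyConstant_anti hsub ⟨u, hu, hu0⟩, ?_, u, huΩ, ?_⟩
  · refine csInf_lt_of_lt (HardyBoundary.bddBelow_hardyQuotients _) ⟨u, hu, hu0, rfl⟩ ?_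
    rw [HardyBoundary.energy_eq_of_support hu.support_subset,
      HardyBoundary.hardyTerm_eq_of_support hu.support_subset, div_lt_iff₀ hpos]
    exact hlt
  · rw [HardyBoundary.energy_eq_of_support huΩ.support_subset,
      HardyBoundary.hardyTerm_eq_of_support huΩ.support_subset]
    exact hlt
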